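/- Let $\mathcal M\subseteq B(H)$ be a diffuse finite von Neumann algebra (diffuse means that $\mathcal M$ has no minimal nonzero projections) with a normal faithful tracial state $\tau$. Suppose $0<\beta\le\frac25$ and let $e_1,e_2,e_3\in\mathcal M$ be (self-adjoint) projections with $\tau(e_i)\ge\frac12+\frac\beta4$ for $i\in\{1,2,3\}$. Then there is a projection $p\in\mathcal M$ satisfying $\tau(p)\le\frac32\beta$ and $\tau(p\wedge e_i)\ge\beta$ for all $i\in\{1,2,3\}$, where $p\wedge e_i$ denotes the orthogonal projection onto $pH\cap e_iH$. -/

import Mathlib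

open scoped ComplexOrder

noncomputable section

namespace VonNeumannAlgebra

variable {H : Type*} [NormedAddCommGroup H] [InnerProductSpace ℂ H] [CompleteSpace H]

/-- A von Neumann algebra is finite if every isometry in it is unitary. -/
def IsFinite (M : VonNeumannAlgebra H) : Prop :=
  ∀ v : M.toStarSubalgebra, star v * v = 1 → v * star v = 1

/-- Normal faithful tracial states. The order on `M` is the operator order on `H →L[ℂ] H`. -/
structure IsNormalFaithfulTracialState (M : VonNeumannAlgebra H)
    (τ : M.toStarSubalgebra →ₗ[ℂ] ℂ) : Prop where
  nonneg : ∀ x : M.toStarSubalgebra, 0 ≤ τ (star x * x)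
  map_one : τ 1 = 1
  tracial : ∀ x y : M.toStarSubalgebra, τ (x * y) = τ (y * x)
  faithful : ∀ x : M.toStarSubalgebra, τ (star x * x) = 0 → x = 0
  /-- Normality: `τ` preserves suprema of bounded increasing nets of self-adjoint elements. -/
  normal : ∀ (S : Set M.toStarSubalgebra) (x : M.toStarSubalgebra),
    S.Nonempty → DirectedOn (· ≤ ·) S → (∀ s ∈ S, IsSelfAdjoint s) → IsLUB S x →
      IsLUB ((fun s => (τ s).re) '' S) (τ x).re

/-- The projections (self-adjoint idempotents) of `M`. -/
abbrev Proj (M : VonNeumannAlgebra H) : Type _ :=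
  {p : M.toStarSubalgebra // IsStarProjection p}

/-- `M` is diffuse: it has no minimal nonzero projections, that is, below every nonzero
projection `p` of `M` there is a projection of `M` other than `0` and `p`. -/
def IsDiffuse (M : VonNeumannAlgebra H) : Prop :=
  ∀ p : M.Proj, p.1 ≠ 0 → ∃ q : M.Proj, q.1 ≤ p.1 ∧ q.1 ≠ 0 ∧ q.1 ≠ p.1

namespace Proj

variable {M : VonNeumannAlgebra H}

/-- The operator on `H` underlying a projection of `M`. -/
abbrev op (p : M.Proj) : H →L[ℂ] H := (p.1 : H →L[ℂ] H)

theorem isStarProjection_op (p : M.Proj) : IsStarProjection p.op where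
  isIdempotentElem := congrArg Subtype.val p.2.isIdempotentElem
  isSelfAdjoint := congrArg Subtype.val p.2.isSelfAdjoint

instance hasOrthogonalProjection_inf (p q : M.Proj) :
    (p.op.range ⊓ q.op.range).HasOrthogonalProjection := by
  have h : IsClosed ((p.op.range ⊓ q.op.range : Submodule ℂ H) : Set H) :=
    (ContinuousLinearMap.IsIdempotentElem.isClosed_range
      p.isStarProjection_op.isIdempotentElem).inter
    (ContinuousLinearMap.IsIdempotentElem.isClosed_range
      q.isStarProjection_op.isIdempotentElem)
  have := h.completeSpace_coe
  infer_instance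

theorem starProjection_inf_mem (p q : M.Proj) :
    (p.op.range ⊓ q.op.range).starProjection ∈ M.toStarSubalgebra := by
  refine (IsStarProjection.mem_iff isStarProjection_starProjection M).2 fun y hy => ?_
  have hp := (IsStarProjection.mem_iff p.isStarProjection_op M).1 p.1.2 y hy
  have hq := (IsStarProjection.mem_iff q.isStarProjection_op M).1 q.1.2 y hy
  rw [Submodule.range_starProjection]
  exact fun x hx => ⟨hp hx.1, hq hx.2⟩

/-- The meet `p ∧ q`: the orthogonal projection onto the intersection of the ranges
`pH ∩ qH`, which belongs to `M`. -/
def inf (p q : M.Proj) : M.Proj :=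
  ⟨⟨(p.op.range ⊓ q.op.range).starProjection, starProjection_inf_mem p q⟩,
    ⟨Subtype.ext isStarProjection_starProjection.isIdempotentElem,
      Subtype.ext isStarProjection_starProjection.isSelfAdjoint⟩⟩

end Proj

end VonNeumannAlgebra

end

/-!
The projections of `M` form a lattice on which `p ↦ τ p` is a dimension function in the sense of
continuous geometry: it is strictly increasing, it satisfies
`d (x ⊔ y) + d (x ⊓ y) = d x + d y`, and it takes all intermediate values on every interval.
Given this, the claim is a statement about modular lattices.

*The dimension function.* The parallelogram law holds because `(1 - q) p` and its adjoint
`p (1 - q)` have kernel projections of equal trace, and these are `(1 - p) + p ∧ q` and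
`q + (1 - p ∨ q)`. To compare the traces of the kernel projections of `x` and `x*` for a
contraction `x`, note that `1 - (1 - x* x) ^ n` increases to the complement of the kernel
projection of `x`, that `τ` does not distinguish `(1 - x* x) ^ n` from `(1 - x x*) ^ n`, and that
`τ` is normal (`re_map_eq_of_ker`). Intermediate values come from Zorn's lemma, since a chain of
projections has a supremum whose trace is the supremum of the traces, and diffuseness says that the
lattice is densely ordered (`exists_eq_of_isLUB_chain`).

*The lattice argument.* In general position, the required `p` is spanned by pieces of dimension
`β / 2` of the three meets `eᵢ ∧ eⱼ`. This falls short when `g = e₁ ∧ e₂ ∧ e₃` is not zero, because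
the pieces overlap in `g`. If `d g < β / 2`, let `s` be the join of three pieces of dimension
`β / 2`, all containing `g`. Modulo `s` the `eᵢ` have at least half of the full dimension, and it
remains to find an element of relative dimension `2 * d g` that meets each of them in relative
dimension `d g`. If `d g ≥ β / 2`, the same task arises modulo a piece `s` of `g`, with `β / 2` in
place of `d g`. For three subspaces `e₁, e₂, e₃` of half dimension in general position, each
`y ≤ e₃` is the graph of an isomorphism between a piece of `e₁` and a piece of `e₂`, and the span of
these is as required. `exists_dim_inf_of_half_le` carries this out in arbitrary position: each
degeneracy lowers the dimension of the span by as much as is needed to enlarge the deficient meet.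
-/

open scoped ComplexOrder
open Filter Topology

noncomputable section

/-! ### Continuous dimension functions on lattices -/

/-- A dimension function on a lattice: a strictly increasing real valuation that takes every
intermediate value on every interval. -/
structure IsContinuousDimension {L : Type*} [Lattice L] (d : L → ℝ) : Prop where
  strictMono : StrictMono d
  sup_add_inf : ∀ x y, d (x ⊔ y) + d (x ⊓ y) = d x + d y
  exists_eq : ∀ a b t, a ≤ b → d a ≤ t → t ≤ d b → ∃ c, a ≤ c ∧ c ≤ b ∧ d c = t

namespace IsContinuousDimension

variable {L : Type*} [Lattice L] {d : L → ℝ}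

/-- Both sides of the modular law have the same dimension. -/
theorem sup_inf_eq (hd : IsContinuousDimension d) (x y : L) {z : L} (h : x ≤ z) :
    (x ⊔ y) ⊓ z = x ⊔ y ⊓ z := by
  have hle : x ⊔ y ⊓ z ≤ (x ⊔ y) ⊓ z :=
    sup_le (le_inf le_sup_left h) (inf_le_inf_right z le_sup_right)
  by_contra hne
  have hlt := hd.strictMono (lt_of_le_of_ne hle (Ne.symm hne))
  have h1 := hd.sup_add_inf (x ⊔ y) z
  have h2 := hd.sup_add_inf x (y ⊓ z)
  have h3 := hd.sup_add_inf y z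
  have h4 := hd.sup_add_inf x y
  have h5 : x ⊔ y ⊔ z = y ⊔ z := by
    rw [sup_right_comm, sup_eq_right.2 h, sup_comm]
  have h6 : x ⊓ (y ⊓ z) = x ⊓ y := by
    rw [← inf_assoc, inf_eq_left]
    exact inf_le_left.trans h
  rw [h5] at h1
  rw [h6] at h2
  linarith

/-- Enlarging `p` by an element of `e` makes `p ⊓ e` as large as `e` allows, and the dimension
of `p` does not increase by more than that of `p ⊓ e`. -/
theorem exists_le_dim_inf (hd : IsContinuousDimension d) {p e : L} {t u : ℝ}
    (hu : u ≤ d (p ⊓ e)) (hut : u ≤ t) (hte : t ≤ d e) :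
    ∃ p', p ≤ p' ∧ d p' ≤ d p + (t - u) ∧ t ≤ d (p' ⊓ e) := by
  obtain h | h := le_total t (d (p ⊓ e))
  · exact ⟨p, le_rfl, by linarith, h⟩
  · obtain ⟨c, hc, hce, hct⟩ := hd.exists_eq (p ⊓ e) e t inf_le_right h hte
    refine ⟨p ⊔ c, le_sup_left, ?_, ?_⟩
    · have h1 := hd.sup_add_inf p c
      have h2 := hd.strictMono.monotone (le_inf inf_le_left hc : p ⊓ e ≤ p ⊓ c)
      linarith
    · rw [← hct]
      exact hd.strictMono.monotone (le_inf le_sup_right hce)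

/-- Let `e₁, e₂, e₃` have relative dimension at least one half in `[s, ⊤]`. Then some `p ≥ s` of
relative dimension `2t` meets each of them in relative dimension `t`. If the `eᵢ` are in general
position, `p` is spanned by a piece `y` of `e₃` of dimension `t` and the piece of `e₁` that
corresponds to `y` modulo `e₂`. -/
theorem exists_dim_inf_of_half_le [OrderTop L] (hd : IsContinuousDimension d)
    {s e₁ e₂ e₃ : L} {t : ℝ} (ht : 0 ≤ t) (hts : d s + 2 * t ≤ d ⊤)
    (h₁ : s ≤ e₁) (h₂ : s ≤ e₂) (h₃ : s ≤ e₃)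
    (hd₁ : d ⊤ + d s ≤ 2 * d e₁) (hd₂ : d ⊤ + d s ≤ 2 * d e₂) (hd₃ : d ⊤ + d s ≤ 2 * d e₃) :
    ∃ p, s ≤ p ∧ d p ≤ d s + 2 * t ∧
      d s + t ≤ d (p ⊓ e₁) ∧ d s + t ≤ d (p ⊓ e₂) ∧ d s + t ≤ d (p ⊓ e₃) := by
  have hm := hd.strictMono.monotone
  have hs12 : d s ≤ d (e₁ ⊓ e₂) := hm (le_inf h₁ h₂)
  obtain hr | hr := le_total (d s + t) (d (e₁ ⊓ e₂))
  · -- A piece `x` of `e₁ ⊓ e₂` already serves `e₁` and `e₂`.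
    obtain ⟨x, hsx, hx, hdx⟩ :=
      hd.exists_eq s (e₁ ⊓ e₂) (d s + t) (le_inf h₁ h₂) (by linarith) hr
    obtain ⟨p, hxp, hp, hp3⟩ := hd.exists_le_dim_inf (p := x) (e := e₃) (t := d s + t) (u := d s)
      (hm (le_inf hsx h₃)) (by linarith) (by linarith)
    have hx1 := hm (le_inf hxp (hx.trans inf_le_left))
    have hx2 := hm (le_inf hxp (hx.trans inf_le_right))
    exact ⟨p, hsx.trans hxp, by linarith, by linarith, by linarith, hp3⟩
  · -- `e₁ ⊓ e₂` serves `e₁` and `e₂` up to its dimension, and the relative dimension of `y` is what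
    -- is then missing from `t`. The half-dimension hypotheses make `e₃ ⊓ (e₁ ⊔ e₂)` large enough to
    -- contain `y`, and `f`, which contains `e₁ ⊓ e₂`, is the projection of `y` to `e₁` along `e₂`.
    have h12 := hd.sup_add_inf e₁ e₂
    have h123 := hd.sup_add_inf e₃ (e₁ ⊔ e₂)
    have htop := hm (le_top : e₃ ⊔ (e₁ ⊔ e₂) ≤ ⊤)
    obtain ⟨y, hsy, hy, hdy⟩ := hd.exists_eq s (e₃ ⊓ (e₁ ⊔ e₂)) (2 * d s + t - d (e₁ ⊓ e₂))
      (le_inf h₃ (h₁.trans le_sup_left)) (by linarith) (by linarith)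
    have hy3 : y ≤ e₃ := hy.trans inf_le_left
    have hy12 : y ≤ e₁ ⊔ e₂ := hy.trans inf_le_right
    set f := e₁ ⊓ (y ⊔ e₂) with hf
    have hf1 : f ≤ e₁ := inf_le_left
    have hsf : s ≤ f := le_inf h₁ (hsy.trans le_sup_left)
    have hfe : f ⊔ e₂ = y ⊔ e₂ := by
      have := hd.sup_inf_eq e₂ e₁ (le_sup_right : e₂ ≤ y ⊔ e₂)
      rw [hf, sup_comm, ← this, sup_comm e₂ e₁]
      exact inf_eq_right.2 (sup_le hy12 le_sup_right)
    have hdf := hd.sup_add_inf e₁ (y ⊔ e₂)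
    rw [← hf, show e₁ ⊔ (y ⊔ e₂) = e₁ ⊔ e₂ from
      le_antisymm (sup_le le_sup_left (sup_le hy12 le_sup_right))
        (sup_le le_sup_left (le_sup_right.trans le_sup_right))] at hdf
    have hye := hd.sup_add_inf y e₂
    have hfy := hd.sup_add_inf f y
    have hfye := hd.sup_add_inf (f ⊔ y) e₂
    rw [show f ⊔ y ⊔ e₂ = y ⊔ e₂ from le_antisymm
      (sup_le (sup_le (le_sup_left.trans hfe.le) le_sup_left) le_sup_right)
      (sup_le_sup_right le_sup_right e₂)] at hfye
    have hsye := hm (le_inf hsy h₂)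
    have hsfy := hm (le_inf hsf hsy)
    have hfp := hm (le_inf le_sup_left hf1 : f ≤ (f ⊔ y) ⊓ e₁)
    have hyp := hm (le_inf le_sup_right hy3 : y ≤ (f ⊔ y) ⊓ e₃)
    -- The three meets with `f ⊔ y` fall short of `d s + t` by at most the amount by which
    -- `d (f ⊔ y)` falls short of `d s + 2 * t`.
    obtain ⟨p₁, hp₁, hdp₁, hpe₁⟩ := hd.exists_le_dim_inf (p := f ⊔ y) (e := e₁)
      (t := d s + t) (u := d f) hfp (by linarith) (by linarith)
    obtain ⟨p₂, hp₂, hdp₂, hpe₂⟩ := hd.exists_le_dim_inf (p := p₁) (e := e₂)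
      (t := d s + t) (u := d ((f ⊔ y) ⊓ e₂)) (hm (inf_le_inf_right e₂ hp₁))
      (by linarith) (by linarith)
    obtain ⟨p, hp, hdp, hpe₃⟩ := hd.exists_le_dim_inf (p := p₂) (e := e₃)
      (t := d s + t) (u := d y)
      (hyp.trans (hm (inf_le_inf_right e₃ (hp₁.trans hp₂)))) (by linarith) (by linarith)
    refine ⟨p, (hsf.trans le_sup_left).trans (hp₁.trans (hp₂.trans hp)), by linarith, ?_, ?_, hpe₃⟩
    · exact hpe₁.trans (hm (inf_le_inf_right e₁ (hp₂.trans hp)))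
    · exact hpe₂.trans (hm (inf_le_inf_right e₂ hp))

/-- The lattice form of the result. With `g = e₁ ⊓ e₂ ⊓ e₃`, the element `p` is found above a piece
`s` of `g` if `g` is large, and above a join `s` of pieces of the `eᵢ ⊓ eⱼ` if `g` is small; in
both cases the `eᵢ ⊔ s` have relative dimension at least one half above `s`. -/
theorem exists_dim_le_and_le_dim_inf [BoundedOrder L] (hd : IsContinuousDimension d)
    (hbot : d ⊥ = 0) (htop : d ⊤ = 1) {β : ℝ} (hβ : 0 < β)
    (hβ' : β ≤ 2 / 3) {e₁ e₂ e₃ : L} (h₁ : 1 / 2 + β / 4 ≤ d e₁) (h₂ : 1 / 2 + β / 4 ≤ d e₂)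
    (h₃ : 1 / 2 + β / 4 ≤ d e₃) :
    ∃ p, d p ≤ 3 / 2 * β ∧ β ≤ d (p ⊓ e₁) ∧ β ≤ d (p ⊓ e₂) ∧ β ≤ d (p ⊓ e₃) := by
  have hm := hd.strictMono.monotone
  set g := e₁ ⊓ e₂ ⊓ e₃ with hg
  have hg1 : g ≤ e₁ := inf_le_left.trans inf_le_left
  have hg2 : g ≤ e₂ := inf_le_left.trans inf_le_right
  have hg3 : g ≤ e₃ := inf_le_right
  have hg0 : 0 ≤ d g := hbot ▸ hm bot_le
  obtain hγ | hγ := le_total (β / 2) (d g)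
  · obtain ⟨s, -, hsg, hs⟩ := hd.exists_eq ⊥ g (β / 2) bot_le (by linarith) hγ
    obtain ⟨p, -, hp, hp1, hp2, hp3⟩ := hd.exists_dim_inf_of_half_le (t := β / 2) (by linarith)
      (by linarith) (hsg.trans hg1) (hsg.trans hg2) (hsg.trans hg3)
      (by linarith) (by linarith) (by linarith)
    exact ⟨p, by linarith, by linarith, by linarith, by linarith⟩
  · have key : ∀ x y : L, 1 / 2 + β / 4 ≤ d x → 1 / 2 + β / 4 ≤ d y → g ≤ x → g ≤ y →
        ∃ c, g ≤ c ∧ c ≤ x ∧ c ≤ y ∧ d c = β / 2 := fun x y hx hy hgx hgy ↦ by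
      have hxy := hd.sup_add_inf x y
      have := hm (le_top : x ⊔ y ≤ ⊤)
      obtain ⟨c, hgc, hc, hdc⟩ := hd.exists_eq g (x ⊓ y) (β / 2) (le_inf hgx hgy) hγ (by linarith)
      exact ⟨c, hgc, hc.trans inf_le_left, hc.trans inf_le_right, hdc⟩
    obtain ⟨a, hga, ha2, ha3, hda⟩ := key e₂ e₃ h₂ h₃ hg2 hg3
    obtain ⟨b, hgb, hb1, hb3, hdb⟩ := key e₁ e₃ h₁ h₃ hg1 hg3
    obtain ⟨c, hgc, hc1, hc2, hdc⟩ := key e₁ e₂ h₁ h₂ hg1 hg2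
    -- Any two of `a, b, c` meet in `g`, and so does each with the join of the other two.
    have sup2 : ∀ x y : L, d x = β / 2 → d y = β / 2 → g ≤ x → g ≤ y → x ⊓ y ≤ g →
        d (x ⊔ y) = β - d g := fun x y hx hy hgx hgy h ↦ by
      have := hd.sup_add_inf x y
      rw [le_antisymm h (le_inf hgx hgy)] at this
      linarith
    have hab := sup2 a b hda hdb hga hgb
      (le_inf (le_inf (inf_le_right.trans hb1) (inf_le_left.trans ha2)) (inf_le_left.trans ha3))
    have hac := sup2 a c hda hdc hga hgc
      (le_inf (le_inf (inf_le_right.trans hc1) (inf_le_left.trans ha2)) (inf_le_left.trans ha3))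
    have hbc := sup2 b c hdb hdc hgb hgc
      (le_inf (le_inf (inf_le_left.trans hb1) (inf_le_right.trans hc2)) (inf_le_left.trans hb3))
    set s := a ⊔ b ⊔ c with hs
    have has : a ≤ s := le_sup_left.trans le_sup_left
    have hbs : b ≤ s := le_sup_right.trans le_sup_left
    have hcs : c ≤ s := le_sup_right
    have hds : d s = 3 / 2 * β - 2 * d g := by
      have h := hd.sup_add_inf (a ⊔ b) c
      rw [le_antisymm (le_inf (le_inf (inf_le_right.trans hc1) (inf_le_right.trans hc2))
        (inf_le_left.trans (sup_le ha3 hb3)) : (a ⊔ b) ⊓ c ≤ g)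
        (le_inf (hga.trans le_sup_left) hgc)] at h
      linarith
    -- With `x ⊔ y` the join of the two of `a, b, c` that lie below `e`, one has `s ⊓ e = x ⊔ y`.
    have meet : ∀ x y w e : L, x ≤ e → y ≤ e → g ≤ x → w ⊓ e ≤ g → s = x ⊔ y ⊔ w →
        d (x ⊔ y) = β - d g → d (s ⊓ e) = β - d g := fun x y w e hx hy hgx hw hsw hxy ↦ by
      rw [← hxy, hsw, hd.sup_inf_eq _ _ (sup_le hx hy),
        sup_eq_left.2 (hw.trans (hgx.trans le_sup_left))]
    have hse1 : d (s ⊓ e₁) = β - d g := meet b c a e₁ hb1 hc1 hgb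
      (le_inf (le_inf inf_le_right (inf_le_left.trans ha2)) (inf_le_left.trans ha3))
      (by rw [hs, sup_assoc, sup_comm]) hbc
    have hse2 : d (s ⊓ e₂) = β - d g := meet a c b e₂ ha2 hc2 hga
      (le_inf (le_inf (inf_le_left.trans hb1) inf_le_right) (inf_le_left.trans hb3))
      (by rw [hs, sup_right_comm]) hac
    have hse3 : d (s ⊓ e₃) = β - d g := meet a b c e₃ ha3 hb3 hga
      (le_inf (le_inf (inf_le_left.trans hc1) (inf_le_left.trans hc2)) inf_le_right) rfl hab
    have hs1 := hd.sup_add_inf s e₁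
    have hs2 := hd.sup_add_inf s e₂
    have hs3 := hd.sup_add_inf s e₃
    obtain ⟨p, hsp, hp, hp1, hp2, hp3⟩ := hd.exists_dim_inf_of_half_le (s := s) (e₁ := s ⊔ e₁)
      (e₂ := s ⊔ e₂) (e₃ := s ⊔ e₃) (t := d g) hg0 (by linarith) le_sup_left le_sup_left
      le_sup_left (by linarith) (by linarith) (by linarith)
    -- By modularity `p ⊓ (s ⊔ e) = s ⊔ (p ⊓ e)`, so `p ⊓ e` inherits the excess over `s`.
    have fin : ∀ e : L, d s + d g ≤ d (p ⊓ (s ⊔ e)) → d (s ⊓ e) = β - d g → β ≤ d (p ⊓ e) :=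
      fun e he hse ↦ by
      rw [inf_comm, hd.sup_inf_eq _ _ hsp, inf_comm e p] at he
      have h := hd.sup_add_inf s (p ⊓ e)
      rw [← inf_assoc, inf_eq_left.2 hsp] at h
      linarith
    exact ⟨p, by linarith, fin _ hp1 hse1, fin _ hp2 hse2, fin _ hp3 hse3⟩

end IsContinuousDimension

/-- Intermediate values in an order in which chains have suprema and infima compatible with `d`:
if `x` is maximal among the elements of `[a, b]` with `d ≤ t`, and `y` is minimal among those of
`[x, b]` with `t ≤ d`, then nothing lies strictly between `x` and `y`. -/
theorem exists_eq_of_isLUB_chain {L : Type*} [PartialOrder L] [DenselyOrdered L] {d : L → ℝ}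
    (hsup : ∀ C : Set L, C.Nonempty → IsChain (· ≤ ·) C → ∃ u, IsLUB C u ∧ IsLUB (d '' C) (d u))
    (hinf : ∀ C : Set L, C.Nonempty → IsChain (· ≤ ·) C → ∃ u, IsGLB C u ∧ IsGLB (d '' C) (d u))
    {a b : L} {t : ℝ} (hab : a ≤ b) (ha : d a ≤ t) (hb : t ≤ d b) :
    ∃ c, a ≤ c ∧ c ≤ b ∧ d c = t := by
  obtain ⟨x, hax, hx⟩ := zorn_le_nonempty₀ {x | x ≤ b ∧ d x ≤ t} (fun C hC hchain y hy ↦ by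
    obtain ⟨u, hu, hdu⟩ := hsup C ⟨y, hy⟩ hchain
    exact ⟨u, ⟨hu.2 fun z hz ↦ (hC hz).1, hdu.2 (Set.forall_mem_image.2 fun z hz ↦ (hC hz).2)⟩,
      fun z hz ↦ hu.1 hz⟩) a ⟨hab, ha⟩
  obtain ⟨y, hyb, hy⟩ := zorn_le_nonempty₀ (α := Lᵒᵈ)
    {y | x ≤ OrderDual.ofDual y ∧ t ≤ d (OrderDual.ofDual y)} (fun C hC hchain y hy ↦ by
    obtain ⟨u, hu, hdu⟩ := hinf (OrderDual.toDual ⁻¹' C) ⟨OrderDual.ofDual y, hy⟩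
      (fun z hz w hw hzw ↦ (hchain hz hw hzw).symm)
    exact ⟨OrderDual.toDual u,
      ⟨hu.2 fun z hz ↦ (hC hz).1, hdu.2 (Set.forall_mem_image.2 fun z hz ↦ (hC hz).2)⟩,
      fun z hz ↦ hu.1 hz⟩) (OrderDual.toDual b) ⟨hx.prop.1, hb⟩
  replace hyb : OrderDual.ofDual y ≤ b := hyb
  obtain ⟨hxy, hty⟩ := hy.prop
  obtain heq | hlt := hxy.eq_or_lt
  · exact ⟨x, hax, hx.prop.1, le_antisymm hx.prop.2 (heq ▸ hty)⟩
  · obtain ⟨c, hxc, hcy⟩ := exists_between hlt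
    obtain h | h := le_total (d c) t
    · exact absurd (hx.le_of_ge ⟨hcy.le.trans hyb, h⟩ hxc.le) hxc.not_ge
    · exact absurd (hy.le_of_ge (y := OrderDual.toDual c) ⟨hxc.le, h⟩ hcy.le) hcy.not_ge

/-! ### Strong limits of positive operators -/

namespace ContinuousLinearMap

variable {H : Type*} [NormedAddCommGroup H] [InnerProductSpace ℂ H]

theorem le_of_tendsto_apply {ι : Type*} {l : Filter ι} [l.NeBot] {f : ι → H →L[ℂ] H}
    {T b : H →L[ℂ] H} (hT : ∀ ξ, Tendsto (fun i ↦ f i ξ) l (𝓝 (T ξ)))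
    (hb : ∀ᶠ i in l, f i ≤ b) : T ≤ b := by
  have hpos : ∀ S : H →L[ℂ] H, 0 ≤ S ↔ ∀ ξ, 0 ≤ inner ℂ (S ξ) ξ := fun S ↦ by
    rw [nonneg_iff_isPositive, isPositive_iff_complex]
    refine forall_congr' fun ξ ↦ ?_
    rw [Complex.nonneg_iff, and_comm]
    refine and_congr_right fun _ ↦ ?_
    simp [Complex.ext_iff]
  rw [le_def, ← nonneg_iff_isPositive, hpos]
  intro ξ
  refine ge_of_tendsto ((tendsto_const_nhds (x := b ξ)).sub (hT ξ) |>.inner tendsto_const_nhds) ?_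
  filter_upwards [hb] with i hi
  rw [le_def, ← nonneg_iff_isPositive, hpos] at hi
  exact hi ξ

variable [CompleteSpace H]

/-- If `0 ≤ c ≤ 1` and `P` is the projection onto the fixed points of `c`, then `1 - P` is the
supremum of the increasing sequence `1 - c ^ n`. By the mean ergodic theorem it is already the
strong limit of the averages of this sequence. -/
theorem one_sub_le_of_forall_one_sub_pow_le {c P b : H →L[ℂ] H} (hc₀ : 0 ≤ c) (hc₁ : c ≤ 1)
    (hP : IsStarProjection P) (hfix : ∀ ξ, P ξ = ξ ↔ c ξ = ξ) (hb : ∀ n, 1 - c ^ n ≤ b) :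
    1 - P ≤ b := by
  have hnorm : ‖c‖ ≤ 1 := (CStarAlgebra.norm_le_one_iff_of_nonneg c hc₀).2 hc₁
  have hPc : ∀ ξ, ((c.eqLocus (1 : H →L[ℂ] H)).orthogonalProjectionOnto ξ : H) = P ξ := by
    obtain ⟨K, hK, rfl⟩ := isStarProjection_iff_eq_starProjection.1 hP
    have : K = c.eqLocus (1 : H →L[ℂ] H) := by
      ext ξ
      rw [← Submodule.starProjection_eq_self_iff, hfix]
      rfl
    subst this
    exact fun ξ ↦ rfl
  refine le_of_tendsto_apply (l := atTop)
    (f := fun N : ℕ ↦ (N : ℝ)⁻¹ • ∑ k ∈ Finset.range N, (1 - c ^ k)) (fun ξ ↦ ?_) ?_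
  · have h := (c.tendsto_birkhoffAverage_orthogonalProjection (𝕜 := ℂ) hnorm ξ)
    rw [hPc, birkhoffAverage_congr_ring' ℂ ℝ] at h
    refine (tendsto_const_nhds (x := ξ)).sub h |>.congr' ?_
    filter_upwards [eventually_gt_atTop 0] with N hN
    have hξ : (N : ℝ)⁻¹ • N • ξ = ξ := by
      rw [← Nat.cast_smul_eq_nsmul ℝ, inv_smul_smul₀ (Nat.cast_ne_zero.2 hN.ne')]
    simp [birkhoffAverage, birkhoffSum, smul_sub, hξ]
  · filter_upwards [eventually_gt_atTop 0] with N hN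
    have hN' : (N : ℝ) ≠ 0 := Nat.cast_ne_zero.2 hN.ne'
    calc (N : ℝ)⁻¹ • ∑ k ∈ Finset.range N, (1 - c ^ k)
      _ ≤ (N : ℝ)⁻¹ • ∑ _k ∈ Finset.range N, b :=
          smul_le_smul_of_nonneg_left (Finset.sum_le_sum fun k _ ↦ hb k) (by positivity)
      _ = b := by
          rw [Finset.sum_const, Finset.card_range, ← Nat.cast_smul_eq_nsmul ℝ, inv_smul_smul₀ hN']

theorem le_pow_of_forall_apply_eq {c P : H →L[ℂ] H} (hc₀ : 0 ≤ c) (hP : IsStarProjection P)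
    (hfix : ∀ ξ, P ξ = ξ → c ξ = ξ) (n : ℕ) : P ≤ c ^ n := by
  have hcP : c * P = P := ext fun ξ ↦ hfix _ (congrArg (· ξ) hP.isIdempotentElem.eq)
  have hcnP : c ^ n * P = P := by
    induction n with
    | zero => simp
    | succ n ih => rw [pow_succ, mul_assoc, hcP, ih]
  have hPcn : P * c ^ n = P := by
    have := congrArg star hcnP
    rwa [star_mul, hP.isSelfAdjoint.star_eq, star_pow, hc₀.isSelfAdjoint.star_eq] at this
  -- `c ^ n` is the sum of `P` and its compression to the complement of `P`.
  have h := star_left_conjugate_nonneg (CStarAlgebra.pow_nonneg hc₀ n) (1 - P)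
  rw [star_sub, star_one, hP.isSelfAdjoint.star_eq, sub_mul, one_mul, hPcn, mul_sub, mul_one,
    sub_mul, hcnP, hP.isIdempotentElem.eq, sub_self, sub_zero] at h
  exact sub_nonneg.1 h

end ContinuousLinearMap

/-! ### The projection lattice and the parallelogram law -/

namespace VonNeumannAlgebra

variable {H : Type*} [NormedAddCommGroup H] [InnerProductSpace ℂ H] [CompleteSpace H]
  {M : VonNeumannAlgebra H}

namespace IsNormalFaithfulTracialState

variable {τ : M.toStarSubalgebra →ₗ[ℂ] ℂ}

theorem map_pow_one_sub_star_mul_self (hτ : M.IsNormalFaithfulTracialState τ)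
    (x : M.toStarSubalgebra) (n : ℕ) : τ ((1 - star x * x) ^ n) = τ ((1 - x * star x) ^ n) := by
  induction n with
  | zero => simp
  | succ n ih =>
    have hcomm : x * (1 - star x * x) ^ n = (1 - x * star x) ^ n * x :=
      (SemiconjBy.pow_right (a := x) (show x * (1 - star x * x) = (1 - x * star x) * x by
        rw [mul_sub, sub_mul, mul_one, one_mul, mul_assoc]) n).eq
    have h : τ ((1 - star x * x) ^ n * (star x * x)) = τ ((1 - x * star x) ^ n * (x * star x)) := by
      rw [← mul_assoc, hτ.tracial, ← mul_assoc, hcomm, mul_assoc]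
    rw [pow_succ, pow_succ, mul_sub, mul_sub, mul_one, mul_one, map_sub, map_sub, ih, h]

/-- A kernel projection is the complement of the supremum of the sequence `1 - (1 - x* x) ^ n`, so
normality determines its trace from the traces of the terms. -/
theorem isLUB_one_sub_of_ker (hτ : M.IsNormalFaithfulTracialState τ) {x P : M.toStarSubalgebra}
    (hx : star x * x ≤ 1) (hP : IsStarProjection P)
    (hker : ∀ ξ, (P : H →L[ℂ] H) ξ = ξ ↔ (x : H →L[ℂ] H) ξ = 0) :
    IsLUB (Set.range fun n : ℕ ↦ (τ (1 - (1 - star x * x) ^ n)).re) (τ (1 - P)).re := by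
  have hc₀ : (0 : H →L[ℂ] H) ≤ 1 - star (x : H →L[ℂ] H) * x := sub_nonneg.2 hx
  have hc₁ : 1 - star (x : H →L[ℂ] H) * x ≤ 1 := sub_le_self _ (star_mul_self_nonneg _)
  have hP' : IsStarProjection (P : H →L[ℂ] H) :=
    ⟨congrArg Subtype.val hP.isIdempotentElem, congrArg Subtype.val hP.isSelfAdjoint⟩
  have hfix : ∀ ξ, (P : H →L[ℂ] H) ξ = ξ ↔ (1 - star (x : H →L[ℂ] H) * x) ξ = ξ := fun ξ ↦ by
    rw [hker]
    simp only [sub_apply, one_apply_eq_self, sub_eq_self,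
      mul_apply_eq_comp]
    refine ⟨fun h ↦ by rw [h, map_zero], fun h ↦ ?_⟩
    have := ContinuousLinearMap.adjoint_inner_left (x : H →L[ℂ] H) ξ ((x : H →L[ℂ] H) ξ)
    rw [← ContinuousLinearMap.star_eq_adjoint, h, inner_zero_left] at this
    exact inner_self_eq_zero.1 this.symm
  have hanti := CStarAlgebra.pow_antitone hc₀ hc₁
  have hmono : Monotone fun n : ℕ ↦ (1 : M.toStarSubalgebra) - (1 - star x * x) ^ n :=
    fun m n hmn ↦ sub_le_sub_left (hanti hmn) (1 : H →L[ℂ] H)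
  have hsa : IsSelfAdjoint (1 - star x * x) :=
    (IsSelfAdjoint.one _).sub (IsSelfAdjoint.star_mul_self x)
  rw [Set.range_comp' (fun y : M.toStarSubalgebra ↦ (τ y).re)
    (fun n : ℕ ↦ 1 - (1 - star x * x) ^ n)]
  refine hτ.normal _ _ (Set.range_nonempty _) hmono.directed_le.directedOn_range ?_ ⟨?_, ?_⟩
  · rintro _ ⟨n, rfl⟩
    exact (IsSelfAdjoint.one _).sub (hsa.pow n)
  · rintro _ ⟨n, rfl⟩
    exact sub_le_sub_left (ContinuousLinearMap.le_pow_of_forall_apply_eq hc₀ hP'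
      (fun ξ ↦ (hfix ξ).1) n) (1 : H →L[ℂ] H)
  · intro b hb
    exact ContinuousLinearMap.one_sub_le_of_forall_one_sub_pow_le hc₀ hc₁ hP' hfix
      fun n ↦ hb ⟨n, rfl⟩

/-- The kernel projections of a contraction and of its adjoint have the same trace. -/
theorem re_map_eq_of_ker (hτ : M.IsNormalFaithfulTracialState τ) {x P Q : M.toStarSubalgebra}
    (hx : star x * x ≤ 1) (hx' : x * star x ≤ 1)
    (hP : IsStarProjection P) (hQ : IsStarProjection Q)
    (hkerP : ∀ ξ, (P : H →L[ℂ] H) ξ = ξ ↔ (x : H →L[ℂ] H) ξ = 0)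
    (hkerQ : ∀ ξ, (Q : H →L[ℂ] H) ξ = ξ ↔ ((star x : M.toStarSubalgebra) : H →L[ℂ] H) ξ = 0) :
    (τ P).re = (τ Q).re := by
  have h := hτ.isLUB_one_sub_of_ker hx hP hkerP
  have h' := hτ.isLUB_one_sub_of_ker (x := star x) (by rwa [star_star]) hQ hkerQ
  simp_rw [map_sub, star_star, ← hτ.map_pow_one_sub_star_mul_self] at h'
  simp_rw [map_sub] at h
  have := h.unique h'
  simpa using this

end IsNormalFaithfulTracialState

namespace Proj

theorem apply_apply (p : M.Proj) (ξ : H) : p.op (p.op ξ) = p.op ξ :=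
  congrArg (· ξ) p.isStarProjection_op.isIdempotentElem.eq

theorem mem_range_iff {p : M.Proj} {ξ : H} : ξ ∈ p.op.range ↔ p.op ξ = ξ :=
  ⟨by rintro ⟨η, rfl⟩; exact p.apply_apply η, fun h ↦ ⟨ξ, h⟩⟩

theorem le_iff {p q : M.Proj} : p ≤ q ↔ ∀ ξ, p.op ξ = ξ → q.op ξ = ξ := by
  refine (p.isStarProjection_op.le_iff_mul_eq_right q.isStarProjection_op).trans
    ⟨fun h ξ hξ ↦ ?_, fun h ↦ ContinuousLinearMap.ext fun ξ ↦ h _ (p.apply_apply ξ)⟩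
  rw [← hξ]
  exact congrArg (· ξ) h

theorem op_inf_apply_eq_iff {p q : M.Proj} {ξ : H} :
    (p.inf q).op ξ = ξ ↔ p.op ξ = ξ ∧ q.op ξ = ξ := by
  rw [← mem_range_iff (p := p), ← mem_range_iff (p := q), ← Submodule.mem_inf]
  exact Submodule.starProjection_eq_self_iff

/-- The complementary projection `1 - p`. -/
def compl (p : M.Proj) : M.Proj := ⟨1 - p.1, p.2.one_sub⟩

theorem compl_compl (p : M.Proj) : p.compl.compl = p := Subtype.ext (sub_sub_cancel _ _)

theorem compl_le_compl {p q : M.Proj} (h : p ≤ q) : q.compl ≤ p.compl :=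
  sub_le_sub_left (α := H →L[ℂ] H) h 1

theorem compl_le_comm {p q : M.Proj} : p.compl ≤ q ↔ q.compl ≤ p :=
  ⟨fun h ↦ by simpa only [compl_compl] using compl_le_compl h,
    fun h ↦ by simpa only [compl_compl] using compl_le_compl h⟩

theorem le_compl_comm {p q : M.Proj} : p ≤ q.compl ↔ q ≤ p.compl :=
  ⟨fun h ↦ by simpa only [compl_compl] using compl_le_compl h,
    fun h ↦ by simpa only [compl_compl] using compl_le_compl h⟩

theorem inf_le_left (p q : M.Proj) : p.inf q ≤ p :=
  le_iff.2 fun _ h ↦ (op_inf_apply_eq_iff.1 h).1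

theorem inf_le_right (p q : M.Proj) : p.inf q ≤ q :=
  le_iff.2 fun _ h ↦ (op_inf_apply_eq_iff.1 h).2

theorem le_inf {p q r : M.Proj} (hq : p ≤ q) (hr : p ≤ r) : p ≤ q.inf r :=
  le_iff.2 fun ξ h ↦ op_inf_apply_eq_iff.2 ⟨le_iff.1 hq ξ h, le_iff.1 hr ξ h⟩

/-- The lattice of projections of `M`; joins are obtained from meets by complementation. -/
instance : Lattice M.Proj where
  inf := inf
  sup p q := (p.compl.inf q.compl).compl
  inf_le_left := inf_le_left
  inf_le_right := inf_le_right
  le_inf _ _ _ := le_inf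
  le_sup_left _ _ := le_compl_comm.1 (inf_le_left _ _)
  le_sup_right _ _ := le_compl_comm.1 (inf_le_right _ _)
  sup_le _ _ _ hp hq := compl_le_comm.1 (le_inf (compl_le_compl hp) (compl_le_compl hq))

instance : BoundedOrder M.Proj where
  top := ⟨1, .one _⟩
  bot := ⟨0, .zero _⟩
  le_top p := p.isStarProjection_op.le_one
  bot_le p := p.isStarProjection_op.nonneg

theorem isStarProjection_compl_add_inf (p q : M.Proj) :
    IsStarProjection (p.compl.1 + (p.inf q).1) := by
  have h : p.1 * (p.inf q).1 = (p.inf q).1 := Subtype.ext <|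
    ((p.inf q).isStarProjection_op.le_iff_mul_eq_right p.isStarProjection_op).1 (inf_le_left p q)
  refine p.compl.2.add (p.inf q).2 ?_
  change (1 - p.1) * _ = 0
  rw [sub_mul, one_mul, h, sub_self]

/-- The kernel of `(1 - q) p` is the orthogonal sum of the ranges of `1 - p` and `p ∧ q`. -/
theorem compl_add_inf_apply_eq_iff (p q : M.Proj) (ξ : H) :
    ((p.compl.1 + (p.inf q).1 : M.toStarSubalgebra) : H →L[ℂ] H) ξ = ξ ↔
      ((q.compl.1 * p.1 : M.toStarSubalgebra) : H →L[ℂ] H) ξ = 0 := by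
  have h : (p.inf q).op (p.op ξ) = (p.inf q).op ξ := congrArg (· ξ)
    (((p.inf q).isStarProjection_op.le_iff_mul_eq_left p.isStarProjection_op).1 (inf_le_left p q))
  have h1 : ((p.compl.1 + (p.inf q).1 : M.toStarSubalgebra) : H →L[ℂ] H) ξ
      = ξ - p.op ξ + (p.inf q).op (p.op ξ) := by rw [h]; rfl
  have h2 : ((q.compl.1 * p.1 : M.toStarSubalgebra) : H →L[ℂ] H) ξ
      = p.op ξ - q.op (p.op ξ) := rfl
  rw [h1, h2, sub_add, sub_eq_self, sub_eq_zero, sub_eq_zero, eq_comm, op_inf_apply_eq_iff,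
    eq_comm (a := p.op ξ) (b := q.op (p.op ξ))]
  exact and_iff_right (p.apply_apply ξ)

theorem star_mul_mul_le_one (p q : M.Proj) : star (q.1 * p.1) * (q.1 * p.1) ≤ 1 := by
  have h : star (p.op) * q.op * p.op ≤ star (p.op) * 1 * p.op :=
    star_left_conjugate_le_conjugate q.isStarProjection_op.le_one _
  rw [mul_one, p.isStarProjection_op.isSelfAdjoint.star_eq,
    p.isStarProjection_op.isIdempotentElem.eq] at h
  rw [star_mul, p.2.isSelfAdjoint.star_eq, q.2.isSelfAdjoint.star_eq, mul_assoc, ← mul_assoc q.1,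
    q.2.isIdempotentElem.eq, ← mul_assoc]
  exact h.trans p.isStarProjection_op.le_one

end Proj

namespace IsNormalFaithfulTracialState

variable {τ : M.toStarSubalgebra →ₗ[ℂ] ℂ}

/-- Kaplansky's parallelogram law: the kernel projections of `(1 - q) p` and of its adjoint have
the same trace. -/
theorem re_map_sup_add_inf (hτ : M.IsNormalFaithfulTracialState τ) (p q : M.Proj) :
    (τ (p ⊔ q).1).re + (τ (p ⊓ q).1).re = (τ p.1).re + (τ q.1).re := by
  have hstar : star (q.compl.1 * p.1) = p.1 * q.compl.1 := by
    rw [star_mul, p.2.isSelfAdjoint.star_eq, q.compl.2.isSelfAdjoint.star_eq]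
  have h := hτ.re_map_eq_of_ker (x := q.compl.1 * p.1) (Proj.star_mul_mul_le_one p q.compl)
    (by have := Proj.star_mul_mul_le_one q.compl p
        rwa [← hstar, star_star] at this)
    (Proj.isStarProjection_compl_add_inf p q) (Proj.isStarProjection_compl_add_inf q.compl p.compl)
    (Proj.compl_add_inf_apply_eq_iff p q) (fun ξ ↦ by
      rw [hstar, Proj.compl_add_inf_apply_eq_iff, Proj.compl_compl])
  have hsup : (p ⊔ q).1 = 1 - (q.compl.inf p.compl).1 := by rw [sup_comm]; rfl
  rw [Proj.compl_compl, map_add, map_add, Complex.add_re, Complex.add_re] at h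
  rw [hsup, map_sub, Complex.sub_re]
  change (τ (1 - p.1)).re + _ = _ at h
  rw [map_sub, Complex.sub_re] at h
  change _ + (τ (p.inf q).1).re = _
  linarith

end IsNormalFaithfulTracialState

/-! ### Suprema of chains and intermediate traces -/

namespace Proj

theorem isStarProjection_sub {p q : M.Proj} (h : p ≤ q) : IsStarProjection (q.1 - p.1) := by
  have h' := (p.isStarProjection_op.le_iff_sub q.isStarProjection_op).1 h
  exact ⟨Subtype.ext h'.isIdempotentElem, Subtype.ext h'.isSelfAdjoint⟩

theorem isStarProjection_add {p q : M.Proj} (h : q ≤ p.compl) : IsStarProjection (p.1 + q.1) := by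
  refine p.2.add q.2 (Subtype.ext ?_)
  have := (q.isStarProjection_op.le_iff_mul_eq_right p.compl.isStarProjection_op).1 h
  change (1 - p.op) * q.op = q.op at this
  rw [sub_mul, one_mul, sub_eq_self] at this
  exact this

theorem denselyOrdered (hM : M.IsDiffuse) : DenselyOrdered M.Proj where
  dense a b hab := by
    obtain ⟨q, hq, hq₀, hq₁⟩ := hM ⟨b.1 - a.1, isStarProjection_sub hab.le⟩
      (sub_ne_zero.2 fun h ↦ hab.ne (Subtype.ext h.symm))
    have hqb : a.op + q.op ≤ b.op := by
      rw [add_comm]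
      exact le_sub_iff_add_le.1 (show q.op ≤ b.op - a.op from hq)
    have hqa : q ≤ a.compl :=
      hq.trans (sub_le_sub_right (show b.op ≤ 1 from b.isStarProjection_op.le_one) a.op)
    refine ⟨⟨a.1 + q.1, isStarProjection_add hqa⟩, lt_of_le_of_ne ?_ ?_, lt_of_le_of_ne hqb ?_⟩
    · exact le_add_of_nonneg_right (a := a.op) q.isStarProjection_op.nonneg
    · exact fun h ↦ hq₀ (left_eq_add.1 (congrArg Subtype.val h))
    · exact fun h ↦ hq₁ (eq_sub_of_add_eq' (congrArg Subtype.val h))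

/-- The supremum of a chain of projections, the projection onto the closed span of the ranges, is
also their strong limit and hence their supremum among all elements of `M`. -/
theorem exists_isLUB_chain {C : Set M.Proj} (hne : C.Nonempty) (hC : IsChain (· ≤ ·) C) :
    ∃ u : M.Proj, IsLUB C u ∧ IsLUB (Subtype.val '' C) u.1 := by
  have hle : ∀ {p q : M.Proj}, p ≤ q → p.op.range ≤ q.op.range := fun h ξ hξ ↦
    mem_range_iff.2 (le_iff.1 h ξ (mem_range_iff.1 hξ))
  let U : C → Submodule ℂ H := fun p ↦ p.1.op.range
  have hUproj : ∀ p : C, ∃ _ : (U p).HasOrthogonalProjection, p.1.op = (U p).starProjection :=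
    fun p ↦ isStarProjection_iff_eq_starProjection_range.1
      p.1.isStarProjection_op
  have hinst : ∀ p, (U p).HasOrthogonalProjection := fun p ↦ (hUproj p).1
  have hUmono : Monotone U := fun p q h ↦ hle h
  have : Nonempty C := hne.to_subtype
  have : IsDirectedOrder C := ⟨hC.directed⟩
  let V := (⨆ p, U p).topologicalClosure
  have hVcomplete : CompleteSpace V := (Submodule.isClosed_topologicalClosure _).completeSpace_coe
  have hV : IsStarProjection V.starProjection := isStarProjection_starProjection
  have hmem : V.starProjection ∈ M.toStarSubalgebra := by
    refine (IsStarProjection.mem_iff hV M).2 fun y hy ↦ ?_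
    rw [Submodule.range_starProjection]
    have hU : (⨆ p, U p) ≤ (⨆ p, U p).comap (y : H →ₗ[ℂ] H) := iSup_le fun p ξ hξ ↦
      (le_iSup U p) ((IsStarProjection.mem_iff p.1.isStarProjection_op M).1 p.1.1.2 y hy hξ)
    intro ξ hξ
    exact map_mem_closure y.continuous hξ hU
  let u : M.Proj := ⟨⟨V.starProjection, hmem⟩,
    ⟨Subtype.ext hV.isIdempotentElem, Subtype.ext hV.isSelfAdjoint⟩⟩
  have hub : ∀ p ∈ C, p ≤ u := fun p hp ↦ le_iff.2 fun ξ hξ ↦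
    Submodule.starProjection_eq_self_iff.2
      (Submodule.le_topologicalClosure _ ((le_iSup U ⟨p, hp⟩) (mem_range_iff.2 hξ)))
  have hlim : ∀ ξ, Tendsto (fun p : C ↦ p.1.op ξ) atTop (𝓝 (u.op ξ)) := fun ξ ↦ by
    refine (Submodule.starProjection_tendsto_closure_iSup U hUmono ξ).congr fun p ↦ ?_
    rw [(hUproj p).2]
  have hlub : IsLUB (Subtype.val '' C) u.1 := by
    refine ⟨Set.forall_mem_image.2 hub, fun b hb ↦ ?_⟩
    exact ContinuousLinearMap.le_of_tendsto_apply (b := (b : H →L[ℂ] H)) hlim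
      (.of_forall fun p ↦ hb ⟨p.1, p.2, rfl⟩)
  exact ⟨u, ⟨hub, fun b hb ↦ hlub.2 (Set.forall_mem_image.2 hb)⟩, hlub⟩

end Proj

namespace IsNormalFaithfulTracialState

variable {τ : M.toStarSubalgebra →ₗ[ℂ] ℂ}

theorem strictMono_re_map (hτ : M.IsNormalFaithfulTracialState τ) :
    StrictMono fun p : M.Proj ↦ (τ p.1).re := by
  intro p q hpq
  have h := Proj.isStarProjection_sub hpq.le
  have hstar : star (q.1 - p.1) * (q.1 - p.1) = q.1 - p.1 := by
    rw [h.isSelfAdjoint.star_eq, h.isIdempotentElem.eq]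
  have hnonneg := hτ.nonneg (q.1 - p.1)
  have hne : τ (star (q.1 - p.1) * (q.1 - p.1)) ≠ 0 := fun h0 ↦
    hpq.ne (Subtype.ext (sub_eq_zero.1 (hτ.faithful _ h0)).symm)
  rw [hstar] at hnonneg hne
  have := (Complex.lt_def.1 (lt_of_le_of_ne hnonneg hne.symm)).1
  rw [map_sub, Complex.sub_re, Complex.zero_re] at this
  exact sub_pos.1 this

theorem re_map_compl (hτ : M.IsNormalFaithfulTracialState τ) (p : M.Proj) :
    (τ p.compl.1).re = 1 - (τ p.1).re := by
  change (τ (1 - p.1)).re = _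
  rw [map_sub, hτ.map_one, Complex.sub_re, Complex.one_re]

theorem exists_isLUB_chain (hτ : M.IsNormalFaithfulTracialState τ) {C : Set M.Proj}
    (hne : C.Nonempty) (hC : IsChain (· ≤ ·) C) :
    ∃ u : M.Proj, IsLUB C u ∧ IsLUB ((fun p : M.Proj ↦ (τ p.1).re) '' C) (τ u.1).re := by
  obtain ⟨u, hu, hu'⟩ := Proj.exists_isLUB_chain hne hC
  refine ⟨u, hu, ?_⟩
  have h := hτ.normal (Subtype.val '' C) u.1 (hne.image _) ?_ ?_ hu'
  · rwa [Set.image_image] at h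
  · rintro _ ⟨p, hp, rfl⟩ _ ⟨q, hq, rfl⟩
    obtain ⟨r, hr, hpr, hqr⟩ := hC.directedOn p hp q hq
    exact ⟨r.1, ⟨r, hr, rfl⟩, hpr, hqr⟩
  · rintro _ ⟨p, -, rfl⟩
    exact p.2.isSelfAdjoint

theorem exists_isGLB_chain (hτ : M.IsNormalFaithfulTracialState τ) {C : Set M.Proj}
    (hne : C.Nonempty) (hC : IsChain (· ≤ ·) C) :
    ∃ u : M.Proj, IsGLB C u ∧ IsGLB ((fun p : M.Proj ↦ (τ p.1).re) '' C) (τ u.1).re := by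
  obtain ⟨u, hu, hu'⟩ := hτ.exists_isLUB_chain (hne.image Proj.compl) (by
    rintro _ ⟨p, hp, rfl⟩ _ ⟨q, hq, rfl⟩ hpq
    exact (hC hp hq fun h ↦ hpq (congrArg _ h)).symm.imp Proj.compl_le_compl Proj.compl_le_compl)
  refine ⟨u.compl, ⟨fun p hp ↦ Proj.compl_le_comm.1 (hu.1 ⟨p, hp, rfl⟩),
    fun b hb ↦ Proj.le_compl_comm.1 (hu.2 ?_)⟩, ?_, fun t ht ↦ ?_⟩
  · exact Set.forall_mem_image.2 fun p hp ↦ Proj.compl_le_compl (hb hp)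
  · rintro _ ⟨p, hp, rfl⟩
    have := hu'.1 ⟨_, ⟨p, hp, rfl⟩, rfl⟩
    dsimp only at this ⊢
    rw [hτ.re_map_compl] at this ⊢
    linarith
  · have : (τ u.1).re ≤ 1 - t := hu'.2 (by
      rintro _ ⟨_, ⟨p, hp, rfl⟩, rfl⟩
      have := ht ⟨p, hp, rfl⟩
      dsimp only at this ⊢
      rw [hτ.re_map_compl]
      linarith)
    rw [hτ.re_map_compl]
    linarith

theorem isContinuousDimension (hτ : M.IsNormalFaithfulTracialState τ) (hM : M.IsDiffuse) :
    IsContinuousDimension fun p : M.Proj ↦ (τ p.1).re where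
  strictMono := hτ.strictMono_re_map
  sup_add_inf := hτ.re_map_sup_add_inf
  exists_eq _ _ _ hab ha hb := by
    have := Proj.denselyOrdered hM
    exact exists_eq_of_isLUB_chain (fun _ ↦ hτ.exists_isLUB_chain)
      (fun _ ↦ hτ.exists_isGLB_chain) hab ha hb

end IsNormalFaithfulTracialState

end VonNeumannAlgebra

end

theorem mainTheorem8 {H : Type*} [NormedAddCommGroup H] [InnerProductSpace ℂ H]
    [CompleteSpace H] (M : VonNeumannAlgebra H) (hfin : M.IsFinite) (hdiff : M.IsDiffuse)
    (τ : M.toStarSubalgebra →ₗ[ℂ] ℂ) (hτ : M.IsNormalFaithfulTracialState τ)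
    (β : ℝ) (hβ : 0 < β) (hβ' : β ≤ 2 / 5)
    (e : Fin 3 → M.Proj) (he : ∀ i, 1 / 2 + β / 4 ≤ (τ (e i).1).re) :
    ∃ p : M.Proj, (τ p.1).re ≤ 3 / 2 * β ∧ ∀ i, β ≤ (τ (p.inf (e i)).1).re := by
  obtain ⟨p, hp, h₀, h₁, h₂⟩ := (hτ.isContinuousDimension hdiff).exists_dim_le_and_le_dim_inf
    (show (τ 0).re = 0 by simp) (show (τ 1).re = 1 by simp [hτ.map_one]) hβ (by linarith)
    (he 0) (he 1) (he 2)
  refine ⟨p, hp, fun i ↦ ?_⟩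
  fin_cases i
  exacts [h₀, h₁, h₂]
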